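/- Let $n\ge 2$ be an integer and let $G$ be a finite abelian group isomorphic to $C_2\oplus C_2\oplus C_{2n}$, so that $\exp(G)=2n$. A sequence over $G$ is a finite unordered sequence of elements of $G$ with repetition allowed, i.e. an element of the free abelian monoid over $G$, written multiplicatively; $\sigma(S)$ denotes the sum of the terms of $S$, $\operatorname{supp}(S)$ the set of elements occurring in $S$, and $|S|$ its length. A short zero-sum subsequence is a nonempty subsequence of length at most $\exp(G)$ with sum $0$, and $\eta(G)$ is the smallest integer $\ell\ge 0$ such that every sequence over $G$ of length at least $\ell$ has a short zero-sum subsequence. A basis of $G$ is a generating set $\{f_1,f_2,f_3\}$ that is independent, i.e. $\sum_i a_if_i=0$ with $a_i\in\mathbb Z$ implies $a_if_i=0$ for every $i$. Then $\eta(G)=2n+4$, and a sequence $S$ over $G$ of length $|S|=\eta(G)-1=2n+3$ contains no short zero-sum subsequence if and only if there exists a basis $\{f_1,f_2,f_3\}$ of $G$ with $\operatorname{ord}(f_1)=\operatorname{ord}(f_2)=2$ and $\operatorname{ord}(f_3)=2n$ such that $S$ is equal to one of the following sequences (where the parameters $v,a,b$ are integers): - $(\eta 1)$ $\; f_3^{2n-1-2v}\,(f_3+f_2)^{2v+1}\,f_2\,(af_3+f_1)\,\bigl((1-a)f_3+f_2+f_1\bigr)$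 with $0\le v\le n-1$ and $2\le a\le n-1$; - $(\eta 2)$ $\; f_3^{2n-1}\,(af_3+f_2)\,\bigl((1-a)f_3+f_2\bigr)\,(bf_3+f_1)\,\bigl((1-b)f_3+f_1\bigr)$ with $2\le b\le a\le n-1$; - $(\eta 3)$ $\; \prod_{i=1}^{2n+1}(f_3+d_i)\cdot f_2 f_1$, where $S'=\prod_{i=1}^{2n+1}d_i$ is a sequence over the subgroup $\langle f_1,f_2\rangle$ with $\sigma(S')\notin\operatorname{supp}(S')$. -/

import Mathlib

/-! Sequences over an additive abelian group `G` (elements of the free abelian monoid over `G`) are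
multisets `S : Multiset G`: the length is `S.card`, the sum is `S.sum`, subsequences are `T ≤ S`,
the product of sequences is the sum of multisets, and `g ∈ S` says that `g` lies in the support. -/

namespace ZeroSum

variable {G : Type*} [AddCommGroup G]

/-- A family is independent if `∑ aᵢ gᵢ = 0` with integers `aᵢ` implies `aᵢ gᵢ = 0` for all `i`. -/
def Independent {ι : Type*} [Fintype ι] (g : ι → G) : Prop :=
  ∀ a : ι → ℤ, ∑ i, a i • g i = 0 → ∀ i, a i • g i = 0

/-- A basis is an independent generating family. -/
def IsBasis {ι : Type*} [Fintype ι] (g : ι → G) : Prop :=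
  Independent g ∧ AddSubgroup.closure (Set.range g) = ⊤

/-- `S` has a short zero-sum subsequence: one that is nonempty, of length at most `exp(G)`, and
has sum `0`. -/
def HasShortZeroSum (S : Multiset G) : Prop :=
  ∃ T ≤ S, T ≠ 0 ∧ T.card ≤ AddMonoid.exponent G ∧ T.sum = 0

variable (G) in
/-- The constant `η(G)`: the smallest `ℓ` such that every sequence of length at least `ℓ` has a
short zero-sum subsequence. (It is `0` if there is no such `ℓ`; this does not occur for finite `G`,
and `η(G) > 0` otherwise, as the empty sequence has no nonempty subsequence.) -/
noncomputable def eta : ℕ :=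
  sInf {l : ℕ | ∀ S : Multiset G, l ≤ S.card → HasShortZeroSum S}

/-- `f₃^(2n-1-2v) (f₃+f₂)^(2v+1) f₂ (a f₃+f₁) ((1-a) f₃+f₂+f₁)` with `v ∈ [0, n-1]` and
`a ∈ [2, n-1]`. -/
def FormEta1 (n : ℕ) (f₁ f₂ f₃ : G) (S : Multiset G) : Prop :=
  ∃ (v : ℕ) (a : ℤ), v ≤ n - 1 ∧ 2 ≤ a ∧ a ≤ (n : ℤ) - 1 ∧
    S = Multiset.replicate (2 * n - 1 - 2 * v) f₃ + Multiset.replicate (2 * v + 1) (f₃ + f₂)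
      + {f₂, a • f₃ + f₁, (1 - a) • f₃ + f₂ + f₁}

/-- `f₃^(2n-1) (a f₃+f₂) ((1-a) f₃+f₂) (b f₃+f₁) ((1-b) f₃+f₁)` with `a, b ∈ [2, n-1]` and
`a ≥ b`. -/
def FormEta2 (n : ℕ) (f₁ f₂ f₃ : G) (S : Multiset G) : Prop :=
  ∃ a b : ℤ, 2 ≤ a ∧ a ≤ (n : ℤ) - 1 ∧ 2 ≤ b ∧ b ≤ (n : ℤ) - 1 ∧ b ≤ a ∧
    S = Multiset.replicate (2 * n - 1) f₃
      + {a • f₃ + f₂, (1 - a) • f₃ + f₂, b • f₃ + f₁, (1 - b) • f₃ + f₁}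

/-- `∏ (f₃ + dᵢ) f₂ f₁`, the product over `i ∈ [1, 2n+1]`, where `S' = ∏ dᵢ` is a sequence over
`⟨f₁, f₂⟩` whose sum is not in its support. -/
def FormEta3 (n : ℕ) (f₁ f₂ f₃ : G) (S : Multiset G) : Prop :=
  ∃ S' : Multiset G, S'.card = 2 * n + 1 ∧ (∀ d ∈ S', d ∈ AddSubgroup.closure {f₁, f₂}) ∧
    S'.sum ∉ S' ∧ S = S'.map (fun d => f₃ + d) + {f₂, f₁}

end ZeroSum

/-! Reduce modulo `2`, along a surjection `π` onto `C₂³` with kernel of order `n`. Let `S` have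
length at least `2n + 3` and no short zero-sum subsequence. By the pigeonhole principle `S` contains
`n - 2` disjoint pairs with equal images; their sums lie in the kernel, and together with the sum of
any block (at most four further terms, with sum in the kernel) they form a zero-sum free sequence of
length `n - 1`. Such a sequence has all but one of the kernel's elements as sums already before its
last term, so that term is forced: all blocks among the at least seven remaining terms have one
common nonzero sum. This rigidity fails for six distinct nonzero points of `C₂³`, and it leaves a
repeated pair and five terms whose images are the complement of two points in `C₂³ ∖ {0}`, that is,
two lines through a common point; the lines lift to equations `a + b = x = c + d` in `G`, and the
pairs are repetitions of some of the five terms. Writing `2a = k(2x)` and `2c = l(2x)`, the three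
families are the cases `1 < l ≤ k`, `1 = l < k` and `1 = l = k`. -/

namespace ZeroSum

section Sequences

variable {G : Type*} [AddCommGroup G]

/-- A sequence is zero-sum free if no nonempty subsequence has sum zero. -/
def ZeroSumFree (U : Multiset G) : Prop := ∀ T ≤ U, T ≠ 0 → T.sum ≠ 0

/-- The set of sums of subsequences of `U`, including the empty sum `0`. -/
def subsums (U : Multiset G) : Set G := Multiset.sum '' Set.Iic U

theorem ZeroSumFree.mono {U U' : Multiset G} (h : ZeroSumFree U) (hle : U' ≤ U) :
    ZeroSumFree U' := fun T hT => h T (hT.trans hle)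

theorem zero_mem_subsums (U : Multiset G) : (0 : G) ∈ subsums U :=
  ⟨0, Multiset.zero_le U, Multiset.sum_zero⟩

theorem finite_subsums (U : Multiset G) : (subsums U).Finite := by
  classical exact (Set.finite_Iic U).image _

theorem subsums_mono {U U' : Multiset G} (h : U ≤ U') : subsums U ⊆ subsums U' :=
  Set.image_mono (Set.Iic_subset_Iic.2 h)

theorem add_mem_subsums_cons (x : G) {U : Multiset G} {s : G} (hs : s ∈ subsums U) :
    x + s ∈ subsums (x ::ₘ U) := by
  obtain ⟨T, hT, rfl⟩ := hs
  exact ⟨x ::ₘ T, Multiset.cons_le_cons x hT, Multiset.sum_cons x T⟩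

theorem subsums_subset (K : AddSubgroup G) {U : Multiset G} (hU : ∀ z ∈ U, z ∈ K) :
    subsums U ⊆ K := by
  rintro _ ⟨T, hT, rfl⟩
  exact K.multiset_sum_mem T fun z hz => hU z (Multiset.mem_of_le hT hz)

theorem ZeroSumFree.neg_notMem_subsums {U : Multiset G} {x : G} (h : ZeroSumFree (x ::ₘ U)) :
    -x ∉ subsums U := by
  rintro ⟨T, hT, hTx⟩
  refine h (x ::ₘ T) (Multiset.cons_le_cons x hT) Multiset.cons_ne_zero ?_
  rw [Multiset.sum_cons, hTx, add_neg_cancel]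

theorem ZeroSumFree.card_lt_ncard_subsums {U : Multiset G} (h : ZeroSumFree U) :
    U.card < (subsums U).ncard := by
  induction U using Multiset.induction with
  | empty => exact (Set.ncard_pos (finite_subsums 0)).2 ⟨0, zero_mem_subsums 0⟩
  | cons x U ih =>
    have hlt : (subsums U).ncard < (subsums (x ::ₘ U)).ncard := by
      refine Set.ncard_lt_ncard ⟨subsums_mono (Multiset.le_cons_self U x), fun hsub => ?_⟩
        (finite_subsums _)
      -- Otherwise translation by `x` permutes the finite set `subsums U`, so it attains `0`.
      have hmaps : Set.MapsTo (x + ·) (subsums U) (subsums U) := fun _ hs =>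
        hsub (add_mem_subsums_cons x hs)
      obtain ⟨s, hs, hxs⟩ := ((finite_subsums U).injOn_iff_bijOn_of_mapsTo hmaps).1
        (add_right_injective x).injOn |>.surjOn (zero_mem_subsums U)
      exact h.neg_notMem_subsums (neg_eq_of_add_eq_zero_right hxs ▸ hs)
    have := ih (h.mono (Multiset.le_cons_self U x))
    rw [Multiset.card_cons]
    lia

theorem ZeroSumFree.completion_unique (K : AddSubgroup G) [Finite K] {U : Multiset G} {x y : G}
    (hU : ∀ z ∈ U, z ∈ K) (hx : x ∈ K) (hy : y ∈ K) (hfx : ZeroSumFree (x ::ₘ U))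
    (hfy : ZeroSumFree (y ::ₘ U)) (hcard : U.card + 2 = Nat.card K) : x = y := by
  by_contra hxy
  have hsub : insert (-x) (insert (-y) (subsums U)) ⊆ (K : Set G) :=
    Set.insert_subset (K.neg_mem hx) (Set.insert_subset (K.neg_mem hy) (subsums_subset K hU))
  have hnotMem : -x ∉ insert (-y) (subsums U) := fun h =>
    h.elim (fun h => hxy (neg_injective h)) hfx.neg_notMem_subsums
  have hle : _ ≤ Nat.card K := Set.ncard_le_ncard hsub (Set.toFinite _)
  rw [Set.ncard_insert_of_notMem hnotMem ((finite_subsums U).insert _),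
    Set.ncard_insert_of_notMem hfy.neg_notMem_subsums (finite_subsums U)] at hle
  have := (hfx.mono (Multiset.le_cons_self U x)).card_lt_ncard_subsums
  lia

theorem exists_le_of_le_map {α β : Type*} {f : α → β} {A : Multiset α} {T : Multiset β}
    (h : T ≤ A.map f) : ∃ A' ≤ A, A'.map f = T := by
  induction A, T using Quotient.inductionOn₂ with
  | h l t =>
    obtain ⟨t', ht', hsub⟩ := h
    obtain ⟨l', hl', rfl⟩ := List.sublist_map_iff.1 hsub
    exact ⟨l', hl'.subperm, Quotient.sound ht'⟩

theorem exists_add_eq_of_le_add {α : Type*} {T A B : Multiset α} (h : T ≤ A + B) :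
    ∃ A' ≤ A, ∃ B' ≤ B, A' + B' = T := by
  classical
  refine ⟨T ∩ A, Multiset.inter_le_right, T - A, tsub_le_iff_left.2 h, ?_⟩
  rw [add_comm, Multiset.sub_add_inter]

theorem exists_le_card_eq {α : Type*} {k : ℕ} {S : Multiset α} (h : k ≤ S.card) :
    ∃ T ≤ S, T.card = k := by
  induction S using Quotient.inductionOn with
  | h l => exact ⟨l.take k, (l.take_sublist k).subperm, by simpa using h⟩

theorem zeroSumFree_map_sum {S : Multiset G} (hS : ¬ HasShortZeroSum S)
    {B : Multiset (Multiset G)} (hB : B.join ≤ S) (hne : ∀ X ∈ B, X ≠ 0)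
    (hcard : B.join.card ≤ AddMonoid.exponent G) : ZeroSumFree (B.map Multiset.sum) := by
  intro T hT hT0 hTs
  obtain ⟨B', hB', rfl⟩ := exists_le_of_le_map hT
  have hle : B'.join ≤ B.join := by
    obtain ⟨C, rfl⟩ := Multiset.le_iff_exists_add.1 hB'
    exact Multiset.join_add B' C ▸ Multiset.le_add_right _ _
  refine hS ⟨B'.join, hle.trans hB, fun h0 => ?_, (Multiset.card_le_card hle).trans hcard, ?_⟩
  · obtain ⟨X, hX⟩ := Multiset.exists_mem_of_ne_zero fun h : B' = 0 =>
      hT0 (h ▸ Multiset.map_zero _)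
    refine hne X (Multiset.mem_of_le hB' hX) (Multiset.eq_zero_of_forall_notMem fun z hz => ?_)
    exact Multiset.notMem_zero z (h0 ▸ Multiset.mem_join.2 ⟨X, hX, hz⟩)
  · rw [← hTs, Multiset.sum_join]

end Sequences

theorem exists_mem_notMem_of_card_lt {α : Type*} {M N : Multiset α} (hM : M.Nodup)
    (h : N.card < M.card) : ∃ a ∈ M, a ∉ N := by
  by_contra! hsub
  exact h.not_ge (Multiset.card_le_card ((Multiset.le_iff_subset hM).2 hsub))

section ElementaryTwoGroup

variable {V : Type*} [AddCommGroup V] [Module (ZMod 2) V]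

theorem exists_two_lines (hV : Nat.card V = 8) {M : Multiset V} (hM : M.Nodup) (h0 : 0 ∉ M)
    (hcard : M.card = 5) : ∃ r a c, M = {r, a, r + a, c, r + c} := by
  classical
  have : Finite V := Nat.finite_of_card_ne_zero (by lia)
  have := Fintype.ofFinite V
  have hdouble (v : V) : v + v = 0 := ZModModule.add_self v
  obtain ⟨p, q, hpq, hs⟩ : ∃ p q, p ≠ q ∧ (insert 0 M.toFinset)ᶜ = {p, q} := by
    rw [← Finset.card_eq_two, Finset.card_compl, Finset.card_insert_of_notMem (by simpa using h0),
      Multiset.toFinset_card_of_nodup hM, hcard, ← Nat.card_eq_fintype_card, hV]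
  have hmem (v : V) : v = 0 ∨ v ∈ M ↔ v ≠ p ∧ v ≠ q := by
    simpa [or_iff_not_imp_left] using not_congr (Finset.ext_iff.1 hs v)
  have hp := hdouble p
  have hq := hdouble q
  have hr : p + q ∈ M := by grind
  obtain ⟨a, ha, har⟩ := exists_mem_notMem_of_card_lt (N := {p + q}) hM (by simp [hcard])
  obtain ⟨c, hc, hcr⟩ :=
    exists_mem_notMem_of_card_lt (N := {p + q, a, p + q + a}) hM (by simp [hcard])
  simp only [Multiset.insert_eq_cons, Multiset.mem_cons, Multiset.mem_singleton, not_or] at har hcr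
  have ha2 := hdouble a
  have hc2 := hdouble c
  have hb : p + q + a ∈ M := by grind
  have hd : p + q + c ∈ M := by grind
  refine ⟨p + q, a, c, (Multiset.eq_of_le_of_card_le ?_ (by simp [hcard])).symm⟩
  rw [Multiset.le_iff_subset (by simpa using by grind)]
  simp [Multiset.cons_subset, *]

theorem exists_three_lines (hV : Nat.card V = 8) {M : Multiset V} (hM : M.Nodup) (h0 : 0 ∉ M)
    (hcard : M.card = 6) : ∃ m a b, M = {a, a + m, b, b + m, a + b, a + b + m} := by
  classical
  have : Finite V := Nat.finite_of_card_ne_zero (by lia)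
  have := Fintype.ofFinite V
  have hdouble (v : V) : v + v = 0 := ZModModule.add_self v
  obtain ⟨m, hs⟩ : ∃ m, (insert 0 M.toFinset)ᶜ = {m} := by
    rw [← Finset.card_eq_one, Finset.card_compl, Finset.card_insert_of_notMem (by simpa using h0),
      Multiset.toFinset_card_of_nodup hM, hcard, ← Nat.card_eq_fintype_card, hV]
  have hmem (v : V) : v = 0 ∨ v ∈ M ↔ v ≠ m := by
    simpa [or_iff_not_imp_left] using not_congr (Finset.ext_iff.1 hs v)
  obtain ⟨a, ha, -⟩ := exists_mem_notMem_of_card_lt (N := 0) hM (by simp [hcard])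
  obtain ⟨b, hb, hab⟩ := exists_mem_notMem_of_card_lt (N := {a, a + m}) hM (by simp [hcard])
  simp only [Multiset.insert_eq_cons, Multiset.mem_cons, Multiset.mem_singleton, not_or] at hab
  have hm2 := hdouble m
  have ha2 := hdouble a
  have hb2 := hdouble b
  refine ⟨m, a, b, (Multiset.eq_of_le_of_card_le ?_ (by simp [hcard])).symm⟩
  rw [Multiset.le_iff_subset (by simpa using by grind)]
  simpa [Multiset.cons_subset, *] using by grind

end ElementaryTwoGroup

theorem exists_cons_of_map_eq_cons {α β : Type*} {f : α → β} {A : Multiset α} {y : β}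
    {B : Multiset β} (h : A.map f = y ::ₘ B) : ∃ x A', A = x ::ₘ A' ∧ f x = y ∧ A'.map f = B := by
  classical
  obtain ⟨x, hx, hxy, hB⟩ := (Multiset.map_eq_cons f A B y).2 h
  exact ⟨x, A.erase x, (Multiset.cons_erase hx).symm, hxy, hB⟩

theorem exists_pair_of_not_nodup_map {α β : Type*} {f : α → β} {A : Multiset α}
    (h : ¬(A.map f).Nodup) : ∃ u v A', A = u ::ₘ v ::ₘ A' ∧ f u = f v := by
  simp only [Multiset.nodup_iff_ne_cons_cons, not_forall, not_not] at h
  obtain ⟨y, B, hB⟩ := h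
  obtain ⟨u, A₁, rfl, hu, h₁⟩ := exists_cons_of_map_eq_cons hB
  obtain ⟨v, A₂, rfl, hv, -⟩ := exists_cons_of_map_eq_cons h₁
  exact ⟨u, v, A₂, rfl, hu.trans hv.symm⟩

section Blocks

variable {G V : Type*} [AddCommGroup G] [AddCommGroup V] {π : G →+ V} {W Y : Multiset G}

/-- A block is a nonempty sequence of length at most `4` whose sum lies in the kernel of `π`. -/
structure IsBlock (π : G →+ V) (X : Multiset G) : Prop where
  ne_zero : X ≠ 0
  card_le : X.card ≤ 4
  map_sum : π X.sum = 0

/-- A sequence is rigid if its blocks have one common nonzero sum. -/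
structure IsRigid (π : G →+ V) (W : Multiset G) : Prop where
  sum_ne_zero {X : Multiset G} : X ≤ W → IsBlock π X → X.sum ≠ 0
  sum_eq {X X' : Multiset G} : X ≤ W → X' ≤ W → IsBlock π X → IsBlock π X' → X.sum = X'.sum

theorem IsRigid.mono {W' : Multiset G} (h : IsRigid π W) (hle : W' ≤ W) : IsRigid π W' where
  sum_ne_zero hX := h.sum_ne_zero (hX.trans hle)
  sum_eq hX hX' := h.sum_eq (hX.trans hle) (hX'.trans hle)

theorem IsRigid.not_disjoint {X X' : Multiset G} (h : IsRigid π W) (hle : X + X' ≤ W)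
    (hcard : (X + X').card ≤ 4) (hX : IsBlock π X) (hX' : IsBlock π X') : False := by
  have hadd : IsBlock π (X + X') :=
    ⟨by simp [hX.ne_zero], hcard, by rw [Multiset.sum_add, map_add, hX.map_sum, hX'.map_sum,
      add_zero]⟩
  have hsum := h.sum_eq hle ((Multiset.le_add_right X X').trans hle) hadd hX
  rw [Multiset.sum_add, add_eq_left] at hsum
  exact h.sum_ne_zero ((Multiset.le_add_left X' X).trans hle) hX' hsum

variable [Module (ZMod 2) V]

theorem isBlock_pair {u v : G} (h : π u = π v) : IsBlock π {u, v} where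
  ne_zero := Multiset.cons_ne_zero
  card_le := by simp
  map_sum := by simp [h, ZModModule.add_self]

theorem IsRigid.nodup_and_zero_notMem {Z : Multiset G} (h : IsRigid π (Z + Y)) (hZ : IsBlock π Z)
    (hcard : Z.card ≤ 2) : (Y.map π).Nodup ∧ 0 ∉ Y.map π := by
  constructor
  · by_contra hY
    obtain ⟨u, v, Y', rfl, huv⟩ := exists_pair_of_not_nodup_map hY
    refine h.not_disjoint (X' := {u, v}) ?_ ?_ hZ (isBlock_pair huv)
    · exact Multiset.add_le_add_left (by simp [Multiset.cons_le_cons_iff])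
    · rw [Multiset.card_add, Multiset.card_pair]
      lia
  · intro h0
    obtain ⟨y, hy, hy0⟩ := Multiset.mem_map.1 h0
    refine h.not_disjoint (X' := {y}) ?_ ?_ hZ ⟨by simp, by simp, by simpa using hy0⟩
    · exact Multiset.add_le_add_left (Multiset.singleton_le.2 hy)
    · rw [Multiset.card_add, Multiset.card_singleton]
      lia

theorem exists_two_lines_of_nodup_map (hV : Nat.card V = 8) (hY : (Y.map π).Nodup)
    (h0 : 0 ∉ Y.map π) (hcard : Y.card = 5) :
    ∃ x a b c d, Y = {x, a, b, c, d} ∧ π a + π b = π x ∧ π c + π d = π x := by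
  obtain ⟨r, p, q, h⟩ := exists_two_lines hV hY h0 (by rwa [Multiset.card_map])
  obtain ⟨x, Y, rfl, hx, h⟩ := exists_cons_of_map_eq_cons h
  obtain ⟨a, Y, rfl, ha, h⟩ := exists_cons_of_map_eq_cons h
  obtain ⟨b, Y, rfl, hb, h⟩ := exists_cons_of_map_eq_cons h
  obtain ⟨c, Y, rfl, hc, h⟩ := exists_cons_of_map_eq_cons h
  obtain ⟨d, rfl, hd⟩ := Multiset.map_eq_singleton.1 h
  have hp := ZModModule.add_self p
  have hq := ZModModule.add_self q
  exact ⟨x, a, b, c, d, rfl, by grind, by grind⟩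

theorem exists_three_lines_of_nodup_map (hV : Nat.card V = 8) (hY : (Y.map π).Nodup)
    (h0 : 0 ∉ Y.map π) (hcard : Y.card = 6) :
    ∃ a a' b b' c c', Y = {a, a', b, b', c, c'} ∧ π a + π b + π c = 0 ∧
      π a + π a' = π b + π b' ∧ π a + π a' = π c + π c' := by
  obtain ⟨m, p, q, h⟩ := exists_three_lines hV hY h0 (by rwa [Multiset.card_map])
  obtain ⟨a, Y, rfl, ha, h⟩ := exists_cons_of_map_eq_cons h
  obtain ⟨a', Y, rfl, ha', h⟩ := exists_cons_of_map_eq_cons h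
  obtain ⟨b, Y, rfl, hb, h⟩ := exists_cons_of_map_eq_cons h
  obtain ⟨b', Y, rfl, hb', h⟩ := exists_cons_of_map_eq_cons h
  obtain ⟨c, Y, rfl, hc, h⟩ := exists_cons_of_map_eq_cons h
  obtain ⟨c', rfl, hc'⟩ := Multiset.map_eq_singleton.1 h
  have hp := ZModModule.add_self p
  have hq := ZModModule.add_self q
  exact ⟨a, a', b, b', c, c', rfl, by grind, by grind, by grind⟩

theorem IsRigid.card_ne_six (hV : Nat.card V = 8) (h : IsRigid π Y) (hY : (Y.map π).Nodup)
    (h0 : 0 ∉ Y.map π) : Y.card ≠ 6 := by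
  intro hcard
  obtain ⟨a, a', b, b', c, c', rfl, habc, hab, hac⟩ :=
    exists_three_lines_of_nodup_map hV hY h0 hcard
  have ha := ZModModule.add_self (π a)
  have ha' := ZModModule.add_self (π a')
  have hb := ZModModule.add_self (π b)
  have hle : ({a, b, c} : Multiset G) ≤ {a, a', b, b', c, c'} :=
    (by grind : [a, b, c].Sublist [a, a', b, b', c, c']).subperm
  have habc' : IsBlock π {a, b, c} := ⟨by simp, by simp, by simpa [← add_assoc] using habc⟩
  have hsum (X : List G) (hX : X.Sublist [a, a', b, b', c, c']) (hne : X ≠ [])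
      (hcard : X.length ≤ 4) (hπ : π X.sum = 0) : X.sum = a + b + c := by
    simpa [← add_assoc] using
      h.sum_eq (X := (X : Multiset G)) hX.subperm hle ⟨by simpa using hne, hcard, hπ⟩ habc'
  -- The three further lines and the three complements of pairs.
  have h₁ : a + b' + c' = a + b + c := by
    simpa [← add_assoc] using hsum [a, b', c'] (by grind) (by simp) (by simp) (by simp; grind)
  have h₂ : a' + b + c' = a + b + c := by
    simpa [← add_assoc] using hsum [a', b, c'] (by grind) (by simp) (by simp) (by simp; grind)
  have h₃ : a' + b' + c = a + b + c := by
    simpa [← add_assoc] using hsum [a', b', c] (by grind) (by simp) (by simp) (by simp; grind)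
  have h₄ : a + a' + b + b' = a + b + c := by
    simpa [← add_assoc] using hsum [a, a', b, b'] (by grind) (by simp) (by simp) (by simp; grind)
  have h₅ : a + a' + c + c' = a + b + c := by
    simpa [← add_assoc] using hsum [a, a', c, c'] (by grind) (by simp) (by simp) (by simp; grind)
  have h₆ : b + b' + c + c' = a + b + c := by
    simpa [← add_assoc] using hsum [b, b', c, c'] (by grind) (by simp) (by simp) (by simp; grind)
  have hzero : a + b + c = 0 := by
    linear_combination (norm := module) h₄ + h₅ + h₆ - h₁ - h₂ - h₃
  exact h.sum_ne_zero hle habc' (by simpa [← add_assoc] using hzero)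

theorem IsRigid.card_le_five (hV : Nat.card V = 8) (h : IsRigid π Y) (hY : (Y.map π).Nodup)
    (h0 : 0 ∉ Y.map π) : Y.card ≤ 5 := by
  by_contra! hcard
  obtain ⟨Y', hle, hcard'⟩ := exists_le_card_eq (Nat.succ_le_of_lt hcard)
  have hmap := Multiset.map_le_map (f := π) hle
  exact (h.mono hle).card_ne_six hV (Multiset.nodup_of_le hmap hY)
    (fun h' => h0 (Multiset.mem_of_le hmap h')) hcard'

theorem IsRigid.exists_pair (hV : Nat.card V = 8) (h : IsRigid π W) (hcard : 7 ≤ W.card) :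
    ∃ u v Y, W = u ::ₘ v ::ₘ Y ∧ π u = π v ∧ Y.card = 5 ∧ (Y.map π).Nodup ∧ 0 ∉ Y.map π := by
  have h0 : 0 ∉ W.map π := by
    intro h0
    obtain ⟨z, hz, hz0⟩ := Multiset.mem_map.1 h0
    obtain ⟨Y, rfl⟩ := Multiset.exists_cons_of_mem hz
    obtain ⟨hY, hY0⟩ := h.nodup_and_zero_notMem (Z := {z}) ⟨by simp, by simp, by simpa using hz0⟩
      (by simp)
    have := (h.mono (Multiset.le_cons_self Y z)).card_le_five hV hY hY0
    rw [Multiset.card_cons] at hcard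
    lia
  have hW : ¬(W.map π).Nodup := fun hW => by have := h.card_le_five hV hW h0; lia
  obtain ⟨u, v, Y, rfl, huv⟩ := exists_pair_of_not_nodup_map hW
  obtain ⟨hY, hY0⟩ := IsRigid.nodup_and_zero_notMem (Z := {u, v}) (by simpa using h)
    (isBlock_pair huv) (by simp)
  have hle : Y ≤ u ::ₘ v ::ₘ Y := (Multiset.le_cons_self Y v).trans (Multiset.le_cons_self _ u)
  have := (h.mono hle).card_le_five hV hY hY0
  simp only [Multiset.card_cons] at hcard
  exact ⟨u, v, Y, rfl, huv, by lia, hY, hY0⟩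

theorem IsRigid.pair_eq (hV : Nat.card V = 8) {u v : G} (h : IsRigid π (u ::ₘ v ::ₘ Y))
    (huv : π u = π v) (hcard : Y.card = 5) (hY : (Y.map π).Nodup) (h0 : 0 ∉ Y.map π) :
    u = v ∧ u ∈ Y := by
  have hu : π u ∈ Y.map π := by
    by_contra hu
    have hu0 : π u ≠ 0 := fun hu0 => h.not_disjoint (X := {u}) (X' := {v})
      (by simp [Multiset.cons_le_cons_iff]) (by simp) ⟨by simp, by simp, by simpa⟩
      ⟨by simp, by simp, by simpa [← huv]⟩
    refine (h.mono (W' := u ::ₘ Y) ?_).card_ne_six hV (by simp [hu, hY]) (by simp_all [eq_comm])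
      (by simp [hcard])
    exact Multiset.cons_le_cons u (Multiset.le_cons_self Y v)
  obtain ⟨y, hy, hyu⟩ := Multiset.mem_map.1 hu
  obtain ⟨Y, rfl⟩ := Multiset.exists_cons_of_mem hy
  have huv_le : ({u, v} : Multiset G) ≤ u ::ₘ v ::ₘ y ::ₘ Y := by
    simp [Multiset.cons_le_cons_iff]
  have huy_le : ({u, y} : Multiset G) ≤ u ::ₘ v ::ₘ y ::ₘ Y := by
    simp [Multiset.cons_le_cons_iff]
  have hvy_le : ({v, y} : Multiset G) ≤ u ::ₘ v ::ₘ y ::ₘ Y :=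
    le_trans (by simp [Multiset.cons_le_cons_iff]) (Multiset.le_cons_self _ u)
  have huy := h.sum_eq huv_le huy_le (isBlock_pair huv) (isBlock_pair hyu.symm)
  have hvy := h.sum_eq huv_le hvy_le (isBlock_pair huv) (isBlock_pair (huv.symm.trans hyu.symm))
  rw [Multiset.sum_pair, Multiset.sum_pair, add_left_cancel_iff] at huy
  rw [Multiset.sum_pair, Multiset.sum_pair, add_comm u, add_left_cancel_iff] at hvy
  exact ⟨hvy.trans huy.symm, hvy ▸ hy⟩

theorem IsRigid.lines_eq {u v x a b c d : G} (h : IsRigid π (u ::ₘ v ::ₘ {x, a, b, c, d}))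
    (huv : π u = π v) (hab : π a + π b = π x) (hcd : π c + π d = π x) :
    u + v = x + x ∧ a + b = x ∧ c + d = x := by
  have hx := ZModModule.add_self (π x)
  have hsum (X : List G) (hX : X.Sublist [u, v, x, a, b, c, d]) (hne : X ≠ [])
      (hcard : X.length ≤ 4) (hπ : π X.sum = 0) : X.sum = u + v := by
    simpa using h.sum_eq (X := (X : Multiset G)) (X' := {u, v}) hX.subperm
      (by simp [Multiset.cons_le_cons_iff])
      ⟨by simpa using hne, hcard, hπ⟩ (isBlock_pair huv)
  have h₁ : x + a + b = u + v := by
    simpa [← add_assoc] using hsum [x, a, b] (by grind) (by simp) (by simp) (by simp; grind)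
  have h₂ : x + c + d = u + v := by
    simpa [← add_assoc] using hsum [x, c, d] (by grind) (by simp) (by simp) (by simp; grind)
  have h₃ : a + b + c + d = u + v := by
    simpa [← add_assoc] using hsum [a, b, c, d] (by grind) (by simp) (by simp) (by simp; grind)
  grind

end Blocks

section Reduction

theorem exists_pairs {α β : Type*} [Finite β] (f : α → β) (k : ℕ) {S : Multiset α}
    (h : Nat.card β + 2 * k < S.card + 2) :
    ∃ (E : Multiset (α × α)) (W : Multiset α), E.card = k ∧ (∀ p ∈ E, f p.1 = f p.2) ∧
      S = E.map Prod.fst + E.map Prod.snd + W := by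
  induction k with
  | zero => exact ⟨0, S, by simp⟩
  | succ k ih =>
    obtain ⟨E, W, hE, hpair, rfl⟩ := ih (by lia)
    have hW : ¬(W.map f).Nodup := fun hW => by
      have := Fintype.ofFinite β
      have := Finset.card_le_univ ⟨W.map f, hW⟩
      simp only [Finset.card_mk, Multiset.card_add, Multiset.card_map, ← Nat.card_eq_fintype_card]
        at this h
      lia
    obtain ⟨u, v, W, rfl, huv⟩ := exists_pair_of_not_nodup_map hW
    refine ⟨(u, v) ::ₘ E, W, by simp [hE], by simpa [huv] using hpair, ?_⟩
    simp only [Multiset.map_cons]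
    simp only [← Multiset.singleton_add]
    abel

variable {G V : Type*} [AddCommGroup G] [AddCommGroup V] {π : G →+ V} {n : ℕ}
variable {S W Y : Multiset G}

/-- A surjection onto a group of order `8` whose kernel is as large as in the reduction
`C₂ ⊕ C₂ ⊕ C₂ₙ → C₂³` modulo `2`, from a group of the same exponent `2n`. -/
structure Reduction (π : G →+ V) (n : ℕ) : Prop where
  two_le : 2 ≤ n
  exponent : AddMonoid.exponent G = 2 * n
  surjective : Function.Surjective π
  card_ker : Nat.card π.ker = n
  card_codomain : Nat.card V = 8

theorem Reduction.card_domain (hR : Reduction π n) : Nat.card G = 8 * n := by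
  rw [← AddSubgroup.card_mul_index π.ker, AddSubgroup.index_ker,
    AddMonoidHom.range_eq_top.2 hR.surjective, AddSubgroup.card_top, hR.card_ker,
    hR.card_codomain, mul_comm]

theorem join_map_pair {α : Type*} (E : Multiset (α × α)) :
    (E.map fun p => ({p.1, p.2} : Multiset α)).join = E.map Prod.fst + E.map Prod.snd := by
  induction E using Multiset.induction with
  | empty => simp
  | cons p E ih =>
    rw [Multiset.map_cons, Multiset.join_cons, ih, Multiset.map_cons, Multiset.map_cons]
    simp only [Multiset.insert_eq_cons, ← Multiset.singleton_add]
    abel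

theorem Reduction.zeroSumFree_cons_pairs (hR : Reduction π n) (hS : ¬HasShortZeroSum S)
    {E : Multiset (G × G)} (hcard : E.card + 2 = n)
    (hle : E.map Prod.fst + E.map Prod.snd + W ≤ S) {X : Multiset G} (hX : X ≤ W)
    (hblock : IsBlock π X) : ZeroSumFree (X.sum ::ₘ E.map fun p => p.1 + p.2) := by
  have hjoin : (X ::ₘ E.map fun p => {p.1, p.2}).join = X + (E.map Prod.fst + E.map Prod.snd) := by
    rw [Multiset.join_cons, join_map_pair]
  have := zeroSumFree_map_sum hS (B := X ::ₘ E.map fun p => {p.1, p.2}) ?_ ?_ ?_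
  · simpa using this
  · rw [hjoin, add_comm]
    exact (add_le_add_right hX _).trans hle
  · simpa using ⟨hblock.ne_zero, by grind [Multiset.cons_ne_zero]⟩
  · have := hblock.card_le
    simp only [hjoin, hR.exponent, Multiset.card_add, Multiset.card_map]
    lia

/-- A decomposition of `S` into `n - 1` pairs `E`, each with a common image under `π`, and five
further terms `Y` whose images are nonzero and distinct. -/
structure Decomposition (π : G →+ V) (n : ℕ) (S : Multiset G) (E : Multiset (G × G))
    (Y : Multiset G) : Prop where
  eq_add : S = E.map Prod.fst + E.map Prod.snd + Y
  card_pairs : E.card + 1 = n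
  map_eq : ∀ p ∈ E, π p.1 = π p.2
  card_rest : Y.card = 5
  nodup : (Y.map π).Nodup
  zero_notMem : 0 ∉ Y.map π

theorem Decomposition.card_eq {E : Multiset (G × G)} (hD : Decomposition π n S E Y) :
    S.card = 2 * n + 3 := by
  have := hD.card_pairs
  have := hD.card_rest
  simp only [hD.eq_add, Multiset.card_add, Multiset.card_map]
  lia

variable [Module (ZMod 2) V]

theorem Reduction.isRigid (hR : Reduction π n) (hS : ¬HasShortZeroSum S) {E : Multiset (G × G)}
    (hE : ∀ p ∈ E, π p.1 = π p.2) (hcard : E.card + 2 = n)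
    (hle : E.map Prod.fst + E.map Prod.snd + W ≤ S) : IsRigid π W where
  sum_ne_zero {X} hX hblock := by
    simpa using hR.zeroSumFree_cons_pairs hS hcard hle hX hblock {X.sum} (by simp) (by simp)
  sum_eq {X X'} hX hX' hblock hblock' := by
    have : Finite π.ker :=
      Nat.finite_of_card_ne_zero (by have := hR.two_le; have := hR.card_ker; lia)
    refine ZeroSumFree.completion_unique π.ker ?_ hblock.map_sum hblock'.map_sum
      (hR.zeroSumFree_cons_pairs hS hcard hle hX hblock)
      (hR.zeroSumFree_cons_pairs hS hcard hle hX' hblock') ?_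
    · intro z hz
      obtain ⟨p, hp, rfl⟩ := Multiset.mem_map.1 hz
      rw [AddMonoidHom.mem_ker, map_add, hE p hp, ZModModule.add_self]
    · rw [Multiset.card_map, hcard, hR.card_ker]

theorem Reduction.exists_decomposition (hR : Reduction π n) (hS : ¬HasShortZeroSum S)
    (hcard : 2 * n + 3 ≤ S.card) : ∃ E Y, Decomposition π n S E Y := by
  have hn := hR.two_le
  have hV := hR.card_codomain
  have : Finite V := Nat.finite_of_card_ne_zero (by lia)
  obtain ⟨E, W, hE, hpair, rfl⟩ := exists_pairs π (n - 2) (S := S) (by lia)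
  simp only [Multiset.card_add, Multiset.card_map] at hcard
  obtain ⟨u, v, Y, rfl, huv, hY5, hY, h0⟩ :=
    (hR.isRigid hS hpair (by lia) le_rfl).exists_pair hV (by lia)
  refine ⟨(u, v) ::ₘ E, Y, ?_, by rw [Multiset.card_cons]; lia, by simpa [huv] using hpair, hY5, hY,
    h0⟩
  simp only [Multiset.map_cons]
  simp only [← Multiset.singleton_add]
  abel

theorem Reduction.card_lt (hR : Reduction π n) (hS : ¬HasShortZeroSum S) : S.card < 2 * n + 4 := by
  by_contra! hcard
  obtain ⟨E, Y, hD⟩ := hR.exists_decomposition hS (by lia)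
  have := hD.card_eq
  lia

theorem Decomposition.isRigid {E : Multiset (G × G)} (hD : Decomposition π n S E Y)
    (hR : Reduction π n) (hS : ¬HasShortZeroSum S) {u v : G} (huv : (u, v) ∈ E) :
    IsRigid π (u ::ₘ v ::ₘ Y) := by
  obtain ⟨E, rfl⟩ := Multiset.exists_cons_of_mem huv
  refine hR.isRigid (E := E) hS ?_ (by simpa using hD.card_pairs) (le_of_eq ?_)
  · exact fun p hp => hD.map_eq p (Multiset.mem_cons_of_mem hp)
  · rw [hD.eq_add, Multiset.map_cons, Multiset.map_cons]
    simp only [← Multiset.singleton_add]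
    abel

theorem Decomposition.exists_lines {E : Multiset (G × G)} (hD : Decomposition π n S E Y)
    (hR : Reduction π n) (hS : ¬HasShortZeroSum S) :
    ∃ x a b c d, Y = {x, a, b, c, d} ∧ a + b = x ∧ c + d = x ∧
      ∀ p ∈ E, p.1 = p.2 ∧ p.1 ∈ Y ∧ p.1 + p.1 = x + x := by
  have hV := hR.card_codomain
  obtain ⟨x, a, b, c, d, rfl, hab, hcd⟩ :=
    exists_two_lines_of_nodup_map hV hD.nodup hD.zero_notMem hD.card_rest
  have hlines {u v : G} (huv : (u, v) ∈ E) :=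
    (hD.isRigid hR hS huv).lines_eq (hD.map_eq _ huv) hab hcd
  have hE : 0 < E.card := by
    have := hD.card_pairs
    have := hR.two_le
    lia
  obtain ⟨p, hp⟩ := Multiset.card_pos_iff_exists_mem.1 hE
  refine ⟨x, a, b, c, d, rfl, (hlines hp).2.1, (hlines hp).2.2, fun q hq => ?_⟩
  obtain ⟨heq, hmem⟩ := (hD.isRigid hR hS hq).pair_eq hV (hD.map_eq _ hq) hD.card_rest hD.nodup
    hD.zero_notMem
  exact ⟨heq, hmem, by simpa [← heq] using (hlines hq).1⟩

end Reduction

section Shape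

variable {G V : Type*} [AddCommGroup G] [AddCommGroup V] {π : G →+ V} {n : ℕ}
variable {S U : Multiset G} {x a b c d : G}

/-- The form of an extremal sequence: repeated terms `U`, each doubling to `x + x`, and five terms
`x, a, b, c, d` on two lines `a + b = x` and `c + d = x`. -/
structure Shape (n : ℕ) (S : Multiset G) (x a b c d : G) (U : Multiset G) : Prop where
  eq_add : S = {x, a, b, c, d} + (U + U)
  card_add_one : U.card + 1 = n
  mem : ∀ u ∈ U, u ∈ ({x, a, b, c, d} : Multiset G)
  double_eq : ∀ u ∈ U, u + u = x + x
  add_ab : a + b = x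
  add_cd : c + d = x
  addOrderOf_double : addOrderOf (x + x) = n
  double_mem : ∀ g : G, g + g ∈ AddSubgroup.zmultiples (x + x)
  eq_top : ∀ H : AddSubgroup G, x ∈ H → a ∈ H → c ∈ H → H = ⊤

theorem addOrderOf_double_of_not_hasShortZeroSum (hn : 0 < n)
    (hexp : AddMonoid.exponent G = 2 * n) (hS : ¬HasShortZeroSum S) (hle : U + U ≤ S)
    (hcard : U.card + 1 = n) (hU : ∀ u ∈ U, u + u = x + x) : addOrderOf (x + x) = n := by
  rw [addOrderOf_eq_iff hn]
  constructor
  · rw [← two_nsmul, smul_smul, mul_comm, ← hexp, AddMonoid.exponent_nsmul_eq_zero]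
  · intro k hkn hk hzero
    obtain ⟨T, hT, hTk⟩ := exists_le_card_eq (show k ≤ U.card by lia)
    refine hS ⟨T + T, (add_le_add hT hT).trans hle, ?_, ?_, ?_⟩
    · rw [← Multiset.card_pos, Multiset.card_add]
      lia
    · rw [Multiset.card_add, hexp]
      lia
    · have hdouble : (T.map fun u => u + u) = Multiset.replicate k (x + x) :=
        Multiset.eq_replicate.2
          ⟨by simpa, by simpa using fun u hu => hU u (Multiset.mem_of_le hT hu)⟩
      rw [Multiset.sum_add]
      simpa [hzero] using congrArg Multiset.sum hdouble

theorem eq_top_of_card_lt_two_mul [Finite V] {K : AddSubgroup V}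
    (h : Nat.card V < 2 * Nat.card K) : K = ⊤ := by
  rw [← K.card_mul_index, mul_comm 2] at h
  have hlt : K.index < 2 := Nat.lt_of_mul_lt_mul_left h
  have hne : K.index ≠ 0 := K.index_ne_zero_of_finite
  exact AddSubgroup.index_eq_one.1 (by lia)

theorem Reduction.eq_top_of_nodup_map (hR : Reduction π n) {Y : Multiset G}
    (hY : (Y.map π).Nodup) (hcard : 5 ≤ Y.card) {H : AddSubgroup G} (hYH : ∀ y ∈ Y, y ∈ H)
    (hker : π.ker ≤ H) : H = ⊤ := by
  have hV := hR.card_codomain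
  have : Finite V := Nat.finite_of_card_ne_zero (by lia)
  have hle : Y.card ≤ Nat.card (H.map π) := by
    have hsub : ((⟨Y.map π, hY⟩ : Finset V) : Set V) ⊆ H.map π := by
      intro v hv
      obtain ⟨y, hy, rfl⟩ := Multiset.mem_map.1 hv
      exact AddSubgroup.mem_map_of_mem π (hYH y hy)
    have := Set.ncard_le_ncard hsub
    rwa [Set.ncard_coe_finset, Finset.card_mk, Multiset.card_map] at this
  have htop : H.map π = ⊤ := eq_top_of_card_lt_two_mul (by lia)
  rw [← sup_eq_left.2 hker, ← AddSubgroup.comap_map_eq, htop, AddSubgroup.comap_top]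

variable [Module (ZMod 2) V]

theorem Reduction.ker_eq_zmultiples (hR : Reduction π n) (hx : addOrderOf (x + x) = n) :
    π.ker = AddSubgroup.zmultiples (x + x) := by
  have : Finite π.ker :=
    Nat.finite_of_card_ne_zero (by have := hR.two_le; have := hR.card_ker; lia)
  refine (AddSubgroup.eq_of_le_of_card_ge ?_ ?_).symm
  · rw [AddSubgroup.zmultiples_le, AddMonoidHom.mem_ker, map_add, ZModModule.add_self]
  · rw [hR.card_ker, Nat.card_zmultiples, hx]

theorem Decomposition.shape {E : Multiset (G × G)}
    (hD : Decomposition π n S E {x, a, b, c, d}) (hR : Reduction π n) (hS : ¬HasShortZeroSum S)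
    (hab : a + b = x) (hcd : c + d = x)
    (hE : ∀ p ∈ E, p.1 = p.2 ∧ p.1 ∈ ({x, a, b, c, d} : Multiset G) ∧ p.1 + p.1 = x + x) :
    Shape n S x a b c d (E.map Prod.fst) := by
  have hSU : S = {x, a, b, c, d} + (E.map Prod.fst + E.map Prod.fst) := by
    rw [hD.eq_add, add_comm, Multiset.map_congr rfl fun p hp => (hE p hp).1]
  have hUx : ∀ u ∈ E.map Prod.fst, u + u = x + x := by
    simpa using fun u v huv => (hE (u, v) huv).2.2
  have hcard : (E.map Prod.fst).card + 1 = n := by rw [Multiset.card_map, hD.card_pairs]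
  have hord : addOrderOf (x + x) = n := addOrderOf_double_of_not_hasShortZeroSum
    (by have := hR.two_le; lia) hR.exponent hS (hSU ▸ Multiset.le_add_left _ _) hcard hUx
  have hker := hR.ker_eq_zmultiples hord
  have hmem : ∀ u ∈ E.map Prod.fst, u ∈ ({x, a, b, c, d} : Multiset G) := by
    simpa using fun u v huv => (hE (u, v) huv).2.1
  refine ⟨hSU, hcard, hmem, hUx, hab, hcd, hord, fun g => ?_, ?_⟩
  · rw [← hker, AddMonoidHom.mem_ker, map_add, ZModModule.add_self]
  · intro H hx ha hc
    refine hR.eq_top_of_nodup_map hD.nodup (by simp) (fun y hy => ?_) ?_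
    · have hb : b ∈ H := by rwa [← H.add_mem_cancel_left ha, hab]
      have hd : d ∈ H := by rwa [← H.add_mem_cancel_left hc, hcd]
      simp only [Multiset.insert_eq_cons, Multiset.mem_cons, Multiset.mem_singleton] at hy
      rcases hy with rfl | rfl | rfl | rfl | rfl <;> assumption
    · rw [hker, AddSubgroup.zmultiples_le]
      exact H.add_mem hx hx

theorem Reduction.exists_shape (hR : Reduction π n) (hS : ¬HasShortZeroSum S)
    (hcard : S.card = 2 * n + 3) : ∃ x a b c d U, Shape n S x a b c d U := by
  obtain ⟨E, Y, hD⟩ := hR.exists_decomposition hS hcard.ge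
  obtain ⟨x, a, b, c, d, rfl, hab, hcd, hE⟩ := hD.exists_lines hR hS
  exact ⟨x, a, b, c, d, _, hD.shape hR hS hab hcd hE⟩

end Shape

section StandardBasis

variable {G : Type*} [AddCommGroup G] {n : ℕ} {f₁ f₂ f₃ : G}

theorem independent_of_card {ι : Type*} [Fintype ι] {g : ι → G} {m : ι → ℕ}
    (hm : ∀ i, m i • g i = 0) (hgen : AddSubgroup.closure (Set.range g) = ⊤) (hpos : ∀ i, 0 < m i)
    (hcard : Nat.card G = ∏ i, m i) : Independent g ∧ ∀ i, addOrderOf (g i) = m i := by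
  classical
  have (i : ι) : NeZero (m i) := ⟨(hpos i).ne'⟩
  let φ (i : ι) : ZMod (m i) →+ G := ZMod.lift (m i) ⟨zmultiplesHom G (g i), by simpa using hm i⟩
  let Φ : (∀ i, ZMod (m i)) →+ G := ∑ i, (φ i).comp (Pi.evalAddMonoidHom _ i)
  have hΦ (k : ι → ℤ) : Φ (fun i => k i) = ∑ i, k i • g i := by simp [Φ, φ]
  have hsurj : Function.Surjective Φ := by
    rw [← AddMonoidHom.range_eq_top, ← top_le_iff, ← hgen, AddSubgroup.closure_le]
    rintro _ ⟨i, rfl⟩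
    refine ⟨fun j => (Pi.single i (1 : ℤ) : ι → ℤ) j, ?_⟩
    rw [hΦ, Finset.sum_eq_single i (by simp +contextual) (by simp)]
    simp
  have hinj : Function.Injective Φ := by
    have : Finite G := Finite.of_surjective Φ hsurj
    exact ((Nat.bijective_iff_surjective_and_card Φ).2 ⟨hsurj, by simp [hcard]⟩).1
  have hdvd (k : ι → ℤ) (hk : ∑ i, k i • g i = 0) (i : ι) : (m i : ℤ) ∣ k i := by
    have hzero : (fun i => (k i : ZMod (m i))) = 0 := hinj (by rw [hΦ, hk, map_zero])
    exact (ZMod.intCast_zmod_eq_zero_iff_dvd _ _).1 (congrFun hzero i)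
  refine ⟨fun k hk i => ?_, fun i => ?_⟩
  · obtain ⟨q, hq⟩ := hdvd k hk i
    rw [hq, mul_comm, mul_smul, natCast_zsmul, hm, smul_zero]
  · refine dvd_antisymm (addOrderOf_dvd_of_nsmul_eq_zero (hm i)) (Int.natCast_dvd_natCast.1 ?_)
    have hsum : ∑ j, (Pi.single i (addOrderOf (g i) : ℤ) : ι → ℤ) j • g j = 0 := by
      rw [Finset.sum_eq_single i (by simp +contextual) (by simp)]
      simp
    simpa using hdvd _ hsum i

/-- A basis of `C₂ ⊕ C₂ ⊕ C₂ₙ` whose members have orders `2`, `2` and `2n`. -/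
structure IsStandardBasis (n : ℕ) (f₁ f₂ f₃ : G) : Prop where
  isBasis : IsBasis ![f₁, f₂, f₃]
  addOrderOf_fst : addOrderOf f₁ = 2
  addOrderOf_snd : addOrderOf f₂ = 2
  addOrderOf_trd : addOrderOf f₃ = 2 * n

theorem isStandardBasis_of_card (hn : 0 < n) (hG : Nat.card G = 8 * n) (h₁ : f₁ + f₁ = 0)
    (h₂ : f₂ + f₂ = 0) (h₃ : n • (f₃ + f₃) = 0)
    (hgen : AddSubgroup.closure {f₁, f₂, f₃} = ⊤) : IsStandardBasis n f₁ f₂ f₃ := by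
  have hrange : AddSubgroup.closure (Set.range ![f₁, f₂, f₃]) = ⊤ := by
    rw [← hgen]
    congr 1
    ext
    simp only [Set.mem_range, Fin.exists_fin_succ]
    simp [eq_comm]
  obtain ⟨hind, hord⟩ := independent_of_card (g := ![f₁, f₂, f₃]) (m := ![2, 2, 2 * n])
    (by simp [Fin.forall_fin_succ, two_nsmul, mul_comm 2 n, mul_smul, *]) hrange
    (by simp [Fin.forall_fin_succ, hn]) (by simpa [Fin.prod_univ_three, ← mul_assoc] using hG)
  exact ⟨⟨hind, hrange⟩, hord 0, hord 1, hord 2⟩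

theorem Independent.dvd (hB : Independent ![f₁, f₂, f₃]) {k₁ k₂ k₃ : ℤ}
    (h : k₁ • f₁ + k₂ • f₂ + k₃ • f₃ = 0) :
    (addOrderOf f₁ : ℤ) ∣ k₁ ∧ (addOrderOf f₂ : ℤ) ∣ k₂ ∧ (addOrderOf f₃ : ℤ) ∣ k₃ := by
  have := hB ![k₁, k₂, k₃] (by simpa [Fin.sum_univ_three] using h)
  simp only [addOrderOf_dvd_iff_zsmul_eq_zero]
  exact ⟨this 0, this 1, this 2⟩

theorem IsStandardBasis.dvd (hB : IsStandardBasis n f₁ f₂ f₃) {k₁ k₂ k₃ : ℤ}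
    (h : k₁ • f₁ + k₂ • f₂ + k₃ • f₃ = 0) : 2 ∣ k₁ ∧ 2 ∣ k₂ ∧ (2 * n : ℤ) ∣ k₃ := by
  have := hB.isBasis.1.dvd h
  simpa [hB.addOrderOf_fst, hB.addOrderOf_snd, hB.addOrderOf_trd] using this

theorem IsStandardBasis.formEta3 (hB : IsStandardBasis n f₁ f₂ f₃) {S' : Multiset G}
    (hcard : S'.card = 2 * n + 1) (hmem : ∀ e ∈ S', e = 0 ∨ e = f₁ ∨ e = f₂)
    (hsum : S'.sum = f₁ + f₂) : FormEta3 n f₁ f₂ f₃ (S'.map (f₃ + ·) + {f₂, f₁}) := by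
  have h₁ : f₁ ≠ 0 := fun h => by simpa [h] using hB.addOrderOf_fst
  have h₂ : f₂ ≠ 0 := fun h => by simpa [h] using hB.addOrderOf_snd
  refine ⟨S', hcard, fun e he => ?_, fun he => ?_, rfl⟩
  · rcases hmem e he with rfl | rfl | rfl
    · exact zero_mem _
    · exact AddSubgroup.subset_closure (by simp)
    · exact AddSubgroup.subset_closure (by simp)
  · rw [hsum] at he
    rcases hmem _ he with h | h | h
    · have := (hB.dvd (k₁ := 1) (k₂ := 1) (k₃ := 0) (by simpa using h)).1
      lia
    · exact h₂ (add_eq_left.1 h)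
    · exact h₁ (add_eq_right.1 h)

/-- The sequences of the classification: one of the three families for some standard basis. -/
def HasExtremalForm (n : ℕ) (S : Multiset G) : Prop :=
  ∃ f₁ f₂ f₃ : G, IsStandardBasis n f₁ f₂ f₃ ∧
    (FormEta1 n f₁ f₂ f₃ S ∨ FormEta2 n f₁ f₂ f₃ S ∨ FormEta3 n f₁ f₂ f₃ S)

end StandardBasis

section Coefficients

theorem exists_replicate_add_replicate {α : Type*} {U : Multiset α} {p q : α}
    (h : ∀ u ∈ U, u = p ∨ u = q) :
    ∃ i j, i + j = U.card ∧ U = Multiset.replicate i p + Multiset.replicate j q := by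
  classical
  have hq : U.filter (¬ · = p) = Multiset.replicate (U.filter (¬ · = p)).card q :=
    Multiset.eq_replicate.2 ⟨rfl, by grind [Multiset.mem_filter]⟩
  refine ⟨U.count p, (U.filter (¬ · = p)).card, ?_, ?_⟩
  · rw [← Multiset.card_replicate (U.count p) p, ← Multiset.filter_eq', ← Multiset.card_add,
      Multiset.filter_add_not]
  · rw [← hq, ← Multiset.filter_eq', Multiset.filter_add_not]

variable {G : Type*} [AddCommGroup G] {n : ℕ}
variable {S U : Multiset G} {x a b c d : G}

theorem Shape.swap_left (h : Shape n S x a b c d U) : Shape n S x b a c d U where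
  __ := h
  eq_add := by
    simp only [h.eq_add, Multiset.insert_eq_cons, Multiset.cons_swap a b]
  mem := by simpa [or_left_comm] using h.mem
  add_ab := by rw [add_comm, h.add_ab]
  eq_top H hx hb hc := h.eq_top H hx (by rwa [← H.add_mem_cancel_right hb, h.add_ab]) hc

theorem Shape.swap_pairs (h : Shape n S x a b c d U) : Shape n S x c d a b U where
  __ := h
  eq_add := by
    simp only [h.eq_add, Multiset.insert_eq_cons, ← Multiset.singleton_add]
    abel
  mem := by
    have := h.mem
    simp only [Multiset.insert_eq_cons, Multiset.mem_cons, Multiset.mem_singleton] at this ⊢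
    grind
  add_ab := h.add_cd
  add_cd := h.add_ab
  eq_top H hx hc ha := h.eq_top H hx ha hc

theorem Shape.isStandardBasis (h : Shape n S x a b c d U) (hn : 0 < n) (hG : Nat.card G = 8 * n)
    {f₁ f₂ f₃ : G} (h₁ : f₁ + f₁ = 0) (h₂ : f₂ + f₂ = 0) (h₃ : f₃ + f₃ = x + x)
    (hx : x ∈ AddSubgroup.closure {f₁, f₂, f₃}) (ha : a ∈ AddSubgroup.closure {f₁, f₂, f₃})
    (hc : c ∈ AddSubgroup.closure {f₁, f₂, f₃}) : IsStandardBasis n f₁ f₂ f₃ :=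
  isStandardBasis_of_card hn hG h₁ h₂ (by rw [h₃, ← h.addOrderOf_double, addOrderOf_nsmul_eq_zero])
    (h.eq_top _ hx ha hc)

theorem Shape.exists_coeff (h : Shape n S x a b c d U) (hn : 0 < n) (g : G) :
    ∃ k < n, g + g = k • (x + x) := by
  classical
  have hfin : IsOfFinAddOrder (x + x) := addOrderOf_pos_iff.1 (by rwa [h.addOrderOf_double])
  have hmem := (hfin.mem_zmultiples_iff_mem_range_addOrderOf).1 (h.double_mem g)
  rw [h.addOrderOf_double] at hmem
  simpa [eq_comm] using hmem

theorem Shape.coeff_inj (h : Shape n S x a b c d U) {k l : ℕ} (hk : k < n) (hl : l < n)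
    (heq : k • (x + x) = l • (x + x)) : k = l :=
  nsmul_injOn_Iio_addOrderOf (by simpa [h.addOrderOf_double]) (by simpa [h.addOrderOf_double]) heq

theorem Shape.exists_coeff_left (h : Shape n S x a b c d U) (hn : 2 ≤ n) :
    ∃ a' b', Shape n S x a' b' c d U ∧ ∃ k < n, 1 ≤ k ∧ a' + a' = k • (x + x) := by
  obtain ⟨k, hk, hak⟩ := h.exists_coeff (by lia) a
  rcases Nat.eq_zero_or_pos k with rfl | hpos
  · refine ⟨b, a, h.swap_left, 1, by lia, le_rfl, ?_⟩
    rw [← h.add_ab, one_smul, add_add_add_comm, hak, zero_smul, zero_add]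
  · exact ⟨a, b, h, k, hk, hpos, hak⟩

theorem Shape.exists_coeffs (h : Shape n S x a b c d U) (hn : 2 ≤ n) :
    ∃ a b c d k l, Shape n S x a b c d U ∧ a + a = k • (x + x) ∧ c + c = l • (x + x) ∧ 1 ≤ l ∧
      l ≤ k ∧ k < n := by
  obtain ⟨a, b, h, k, hkn, hk, hak⟩ := h.exists_coeff_left hn
  obtain ⟨c, d, h, l, hln, hl, hcl⟩ := h.swap_pairs.exists_coeff_left hn
  rcases le_total l k with hlk | hkl
  · exact ⟨a, b, c, d, k, l, h.swap_pairs, hak, hcl, hl, hlk, hkn⟩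
  · exact ⟨c, d, a, b, l, k, h, hcl, hak, hk, hkl, hln⟩

theorem Shape.eq_of_mem (h : Shape n S x a b c d U) {k l : ℕ} (hak : a + a = k • (x + x))
    (hcl : c + c = l • (x + x)) (hl : 1 ≤ l) (hlk : l ≤ k) (hkn : k < n) {u : G} (hu : u ∈ U) :
    u = x ∨ u = c ∧ l = 1 ∨ u = a ∧ k = 1 := by
  have hdouble := h.double_eq u hu
  have hmem := h.mem u hu
  have hab := h.add_ab
  have hcd := h.add_cd
  simp only [Multiset.insert_eq_cons, Multiset.mem_cons, Multiset.mem_singleton] at hmem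
  rcases hmem with rfl | rfl | rfl | rfl | rfl
  · exact Or.inl rfl
  · exact Or.inr (Or.inr ⟨rfl, h.coeff_inj hkn (by lia) (by rw [← hak, hdouble, one_smul])⟩)
  · have : k = 0 := h.coeff_inj hkn (by lia) (by rw [← hak, zero_smul]; grind)
    lia
  · exact Or.inr (Or.inl ⟨rfl, h.coeff_inj (by lia) (by lia) (by rw [← hcl, hdouble, one_smul])⟩)
  · have : l = 0 := h.coeff_inj (by lia) (by lia) (by rw [← hcl, zero_smul]; grind)
    lia

end Coefficients

section NormalForms

variable {G : Type*} [AddCommGroup G] {n : ℕ}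
variable {S U : Multiset G} {x a b c d : G}

theorem Shape.right_eq (h : Shape n S x a b c d U) {k : ℕ} (hak : a + a = k • (x + x)) :
    b = (1 - k : ℤ) • x + (a - k • x) := by
  rw [← add_right_inj a, h.add_ab, add_left_comm, ← add_sub_assoc, hak]
  module

theorem Shape.right_add_self (h : Shape n S x a b c d U) (haa : a + a = x + x) : b + b = 0 := by
  rw [← add_right_inj (a + a), add_add_add_comm, h.add_ab, haa, add_zero]

theorem Shape.left_sub (h : Shape n S x a b c d U) (haa : a + a = x + x) : a - x = b := by
  rw [← h.add_ab, sub_add_cancel_left, neg_eq_of_add_eq_zero_left (h.right_add_self haa)]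

theorem Shape.sum_map_sub (h : Shape n S x a b c d U) : ((U + U).map (· - x)).sum = 0 := by
  rw [Multiset.map_add, Multiset.sum_add, ← Multiset.sum_map_add]
  refine Multiset.sum_eq_zero fun y hy => ?_
  obtain ⟨u, hu, rfl⟩ := Multiset.mem_map.1 hy
  rw [sub_add_sub_comm, h.double_eq u hu, sub_self]

theorem Shape.hasExtremalForm_of_forall_eq (h : Shape n S x a b c d U) (hG : Nat.card G = 8 * n)
    {k l : ℕ} (hak : a + a = k • (x + x)) (hcl : c + c = l • (x + x)) (hl : 2 ≤ l) (hlk : l ≤ k)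
    (hkn : k < n) (hU : ∀ u ∈ U, u = x) : HasExtremalForm n S := by
  have hbasis : IsStandardBasis n (c - l • x) (a - k • x) x := by
    have hx : x ∈ AddSubgroup.closure {c - l • x, a - k • x, x} :=
      AddSubgroup.subset_closure (by simp)
    refine h.isStandardBasis (by lia) hG ?_ ?_ rfl hx ?_ ?_
    · rw [sub_add_sub_comm, hcl, smul_add, sub_self]
    · rw [sub_add_sub_comm, hak, smul_add, sub_self]
    · simpa only [sub_add_cancel] using add_mem
        (AddSubgroup.subset_closure (show a - k • x ∈ _ by simp)) (nsmul_mem hx k)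
    · simpa only [sub_add_cancel] using add_mem
        (AddSubgroup.subset_closure (show c - l • x ∈ _ by simp)) (nsmul_mem hx l)
  have hrep : Multiset.replicate (2 * n - 1) x = {x} + (U + U) := by
    have hcard := h.card_add_one
    refine (Multiset.eq_replicate.2 ⟨?_, ?_⟩).symm
    · simp only [Multiset.card_add, Multiset.card_singleton]
      lia
    · simpa [or_imp, forall_and] using hU
  refine ⟨c - l • x, a - k • x, x, hbasis, .inr (.inl
    ⟨k, l, by lia, by lia, by lia, by lia, by lia, ?_⟩)⟩
  rw [h.eq_add, hrep, ← h.right_eq hak, ← h.swap_pairs.right_eq hcl]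
  simp only [natCast_zsmul, add_sub_cancel, Multiset.insert_eq_cons, ← Multiset.singleton_add]
  abel

theorem Shape.hasExtremalForm_of_forall_eq_or_eq (h : Shape n S x a b c d U)
    (hG : Nat.card G = 8 * n) {k : ℕ} (hak : a + a = k • (x + x)) (hcl : c + c = x + x)
    (hk : 2 ≤ k) (hkn : k < n) (hU : ∀ u ∈ U, u = x ∨ u = c) : HasExtremalForm n S := by
  have hdd : d + d = 0 := h.swap_pairs.right_add_self hcl
  have hbasis : IsStandardBasis n (a - k • c) d c := by
    have hc : c ∈ AddSubgroup.closure {a - k • c, d, c} := AddSubgroup.subset_closure (by simp)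
    refine h.isStandardBasis (by lia) hG ?_ hdd hcl ?_ ?_ hc
    · rw [sub_add_sub_comm, hak, ← smul_add, hcl, sub_self]
    · rw [← h.add_cd]
      exact add_mem hc (AddSubgroup.subset_closure (by simp))
    · simpa only [sub_add_cancel] using add_mem
        (AddSubgroup.subset_closure (show a - k • c ∈ _ by simp)) (nsmul_mem hc k)
  have hb : b = (1 - k : ℤ) • c + d + (a - k • c) := by
    rw [← add_right_inj a, h.add_ab, add_left_comm, ← add_sub_assoc, hak, ← hcl, ← h.add_cd]
    module
  obtain ⟨v, w, hvw, rfl⟩ := exists_replicate_add_replicate hU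
  have hcard := h.card_add_one
  refine ⟨a - k • c, d, c, hbasis, .inl ⟨v, k, by lia, by lia, by lia, ?_⟩⟩
  rw [h.eq_add, h.add_cd, ← hb, show 2 * n - 1 - 2 * v = 1 + (w + w) by lia,
    show 2 * v + 1 = 1 + (v + v) by lia]
  simp only [natCast_zsmul, add_sub_cancel, Multiset.insert_eq_cons, ← Multiset.singleton_add,
    Multiset.replicate_add, Multiset.replicate_one]
  abel

theorem Shape.hasExtremalForm_of_double_eq (h : Shape n S x a b c d U) (hn : 0 < n)
    (hG : Nat.card G = 8 * n) (haa : a + a = x + x) (hcc : c + c = x + x)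
    (hU : ∀ u ∈ U, u = x ∨ u = c ∨ u = a) : HasExtremalForm n S := by
  have hax : a - x = b := h.left_sub haa
  have hcx : c - x = d := h.swap_pairs.left_sub hcc
  have hbasis : IsStandardBasis n d b x := by
    have hx : x ∈ AddSubgroup.closure {d, b, x} := AddSubgroup.subset_closure (by simp)
    refine h.isStandardBasis hn hG (h.swap_pairs.right_add_self hcc) (h.right_add_self haa) rfl
      hx ?_ ?_
    · rw [sub_eq_iff_eq_add.1 hax]
      exact add_mem (AddSubgroup.subset_closure (by simp)) hx
    · rw [sub_eq_iff_eq_add.1 hcx]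
      exact add_mem (AddSubgroup.subset_closure (by simp)) hx
  have hS : S = (({x, a, c} + (U + U)).map (· - x)).map (x + ·) + {b, d} := by
    simp only [Multiset.map_map, Function.comp_apply, add_sub_cancel, Multiset.map_id']
    simp only [h.eq_add, Multiset.insert_eq_cons, ← Multiset.singleton_add]
    abel
  have hcard := h.card_add_one
  rw [hS]
  refine ⟨d, b, x, hbasis, .inr (.inr (hbasis.formEta3 ?_ ?_ ?_))⟩
  · simp only [Multiset.insert_eq_cons, Multiset.map_add, Multiset.card_add, Multiset.card_map,
      Multiset.card_cons, Multiset.card_singleton]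
    lia
  · simp only [Multiset.mem_map, forall_exists_index, and_imp, forall_apply_eq_imp_iff₂]
    intro u hu
    have hu' : u = x ∨ u = a ∨ u = c := by
      simp only [Multiset.insert_eq_cons, Multiset.mem_add, Multiset.mem_cons,
        Multiset.mem_singleton, or_self] at hu
      grind
    rcases hu' with rfl | rfl | rfl
    · exact .inl (sub_self u)
    · exact .inr (.inr hax)
    · exact .inr (.inl hcx)
  · rw [Multiset.map_add, Multiset.sum_add, h.sum_map_sub]
    simp [hax, hcx, add_comm]

theorem Shape.hasExtremalForm (h : Shape n S x a b c d U) (hn : 2 ≤ n)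
    (hG : Nat.card G = 8 * n) : HasExtremalForm n S := by
  obtain ⟨a, b, c, d, k, l, h, hak, hcl, hl, hlk, hkn⟩ := h.exists_coeffs hn
  have hU (u : G) (hu : u ∈ U) := h.eq_of_mem hak hcl hl hlk hkn hu
  rcases hl.eq_or_lt with rfl | hl
  · rcases hlk.eq_or_lt with rfl | hk
    · exact h.hasExtremalForm_of_double_eq (by lia) hG (by simpa using hak) (by simpa using hcl)
        (by simpa using hU)
    · exact h.hasExtremalForm_of_forall_eq_or_eq hG hak (by simpa using hcl) hk hkn
        (by simpa [hk.ne'] using hU)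
  · exact h.hasExtremalForm_of_forall_eq hG hak hcl hl hlk hkn
      (by simpa [hl.ne', show k ≠ 1 by lia] using hU)

end NormalForms

section Converse

variable {G : Type*} [AddCommGroup G] {n : ℕ}
variable {S : Multiset G} {f₁ f₂ f₃ : G}

theorem exists_of_le_cons {α : Type*} {T A : Multiset α} {a : α} (h : T ≤ a ::ₘ A) :
    ∃ e ≤ 1, ∃ T' ≤ A, T = Multiset.replicate e a + T' := by
  by_cases ha : a ∈ T
  · obtain ⟨T', rfl⟩ := Multiset.exists_cons_of_mem ha
    exact ⟨1, le_rfl, T', (Multiset.cons_le_cons_iff _).1 h, by simp⟩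
  · exact ⟨0, zero_le_one, T, (Multiset.le_cons_of_notMem ha).1 h, by simp⟩

theorem exists_of_le_singleton {α : Type*} {T : Multiset α} {a : α} (h : T ≤ {a}) :
    ∃ e ≤ 1, T = Multiset.replicate e a :=
  ⟨T.card, by simpa using Multiset.card_le_card h,
    Multiset.eq_replicate_card.2 fun _ hb => Multiset.mem_singleton.1 (Multiset.mem_of_le h hb)⟩

theorem FormEta1.not_hasShortZeroSum (hexp : AddMonoid.exponent G = 2 * n)
    (hB : IsStandardBasis n f₁ f₂ f₃) (h : FormEta1 n f₁ f₂ f₃ S) : ¬HasShortZeroSum S := by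
  obtain ⟨v, a, hv, -, -, rfl⟩ := h
  rintro ⟨T, hT, hT0, hTcard, hTsum⟩
  obtain ⟨T₁, hT₁, T₂, hT₂, rfl⟩ := exists_add_eq_of_le_add hT
  obtain ⟨T₃, hT₃, T₄, hT₄, rfl⟩ := exists_add_eq_of_le_add hT₁
  obtain ⟨i, hi, rfl⟩ := Multiset.le_replicate_iff.1 hT₃
  obtain ⟨j, hj, rfl⟩ := Multiset.le_replicate_iff.1 hT₄
  obtain ⟨e₁, he₁, R₁, hR₁, rfl⟩ := exists_of_le_cons hT₂
  obtain ⟨e₂, he₂, R₂, hR₂, rfl⟩ := exists_of_le_cons hR₁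
  obtain ⟨e₃, he₃, rfl⟩ := exists_of_le_singleton hR₂
  rw [← Multiset.card_pos] at hT0
  simp only [Multiset.card_add, Multiset.card_replicate, Multiset.sum_add,
    Multiset.sum_replicate, hexp] at hT0 hTcard hTsum
  obtain ⟨h₁, h₂, h₃⟩ := hB.dvd (k₁ := e₂ + e₃) (k₂ := j + e₁ + e₃)
    (k₃ := i + j + e₂ * a + e₃ * (1 - a)) (by rw [← hTsum]; module)
  obtain rfl : e₂ = e₃ := by lia
  have hdvd : 2 * n ∣ i + j + e₂ := by
    zify
    convert h₃ using 1
    ring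
  rcases Nat.eq_zero_or_pos (i + j + e₂) with hzero | hpos
  · lia
  · have := Nat.le_of_dvd hpos hdvd
    lia

theorem FormEta2.not_hasShortZeroSum (hexp : AddMonoid.exponent G = 2 * n)
    (hB : IsStandardBasis n f₁ f₂ f₃) (h : FormEta2 n f₁ f₂ f₃ S) : ¬HasShortZeroSum S := by
  obtain ⟨a, b, -, -, -, -, -, rfl⟩ := h
  rintro ⟨T, hT, hT0, hTcard, hTsum⟩
  obtain ⟨T₁, hT₁, T₂, hT₂, rfl⟩ := exists_add_eq_of_le_add hT
  obtain ⟨i, hi, rfl⟩ := Multiset.le_replicate_iff.1 hT₁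
  obtain ⟨e₁, he₁, R₁, hR₁, rfl⟩ := exists_of_le_cons hT₂
  obtain ⟨e₂, he₂, R₂, hR₂, rfl⟩ := exists_of_le_cons hR₁
  obtain ⟨e₃, he₃, R₃, hR₃, rfl⟩ := exists_of_le_cons hR₂
  obtain ⟨e₄, he₄, rfl⟩ := exists_of_le_singleton hR₃
  rw [← Multiset.card_pos] at hT0
  simp only [Multiset.card_add, Multiset.card_replicate, Multiset.sum_add,
    Multiset.sum_replicate, hexp] at hT0 hTcard hTsum
  obtain ⟨h₁, h₂, h₃⟩ := hB.dvd (k₁ := e₃ + e₄) (k₂ := e₁ + e₂)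
    (k₃ := i + e₁ * a + e₂ * (1 - a) + e₃ * b + e₄ * (1 - b)) (by rw [← hTsum]; module)
  obtain rfl : e₁ = e₂ := by lia
  obtain rfl : e₃ = e₄ := by lia
  have hdvd : 2 * n ∣ i + e₁ + e₃ := by
    zify
    convert h₃ using 1
    ring
  rcases Nat.eq_zero_or_pos (i + e₁ + e₃) with hzero | hpos
  · lia
  · have := Nat.le_of_dvd hpos hdvd
    lia

theorem FormEta3.not_hasShortZeroSum (hexp : AddMonoid.exponent G = 2 * n)
    (hB : IsStandardBasis n f₁ f₂ f₃) (h : FormEta3 n f₁ f₂ f₃ S) : ¬HasShortZeroSum S := by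
  obtain ⟨S', hcard, hcl, hsum, rfl⟩ := h
  rintro ⟨T, hT, hT0, hTcard, hTsum⟩
  obtain ⟨T₁, hT₁, T₂, hT₂, rfl⟩ := exists_add_eq_of_le_add hT
  obtain ⟨D, hD, rfl⟩ := exists_le_of_le_map hT₁
  obtain ⟨e₁, he₁, R₁, hR₁, rfl⟩ := exists_of_le_cons hT₂
  obtain ⟨e₂, he₂, rfl⟩ := exists_of_le_singleton hR₁
  obtain ⟨p, q, hpq⟩ := AddSubgroup.mem_closure_pair.1
    (AddSubgroup.multiset_sum_mem _ D fun d hd => hcl d (Multiset.mem_of_le hD hd))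
  have hDsum : (D.map fun d => f₃ + d).sum = D.card • f₃ + D.sum := by
    rw [Multiset.sum_map_add (f := fun _ => f₃) (g := fun d => d)]
    simp
  rw [← Multiset.card_pos] at hT0
  simp only [Multiset.card_add, Multiset.card_replicate, Multiset.sum_add, Multiset.card_map,
    Multiset.sum_replicate, hDsum, hexp] at hT0 hTcard hTsum
  obtain ⟨h₁, h₂, h₃⟩ := hB.dvd (k₁ := p + e₂) (k₂ := q + e₁) (k₃ := D.card)
    (by rw [← hTsum, ← hpq]; module)
  rcases Nat.eq_zero_or_pos D.card with hzero | hpos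
  · rw [Multiset.card_eq_zero.1 hzero, Multiset.sum_zero] at hpq
    obtain ⟨hp, hq, -⟩ := hB.dvd (k₃ := 0) (by rw [hpq, zero_smul, add_zero])
    lia
  · have hle : 2 * n ≤ D.card := Nat.le_of_dvd hpos (mod_cast h₃)
    obtain ⟨E, rfl⟩ := Multiset.le_iff_exists_add.1 hD
    rw [Multiset.card_add] at hcard
    obtain ⟨d, rfl⟩ : ∃ d, E = {d} := Multiset.card_eq_one.1 (by lia)
    obtain ⟨hDcard, rfl, rfl⟩ : D.card = 2 * n ∧ e₁ = 0 ∧ e₂ = 0 := by lia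
    have hD0 : D.sum = 0 := by
      simpa [hDcard, ← hB.addOrderOf_trd, addOrderOf_nsmul_eq_zero] using hTsum
    exact hsum (by simp [hD0])

theorem HasExtremalForm.not_hasShortZeroSum (hexp : AddMonoid.exponent G = 2 * n)
    (h : HasExtremalForm n S) : ¬HasShortZeroSum S := by
  obtain ⟨f₁, f₂, f₃, hB, h | h | h⟩ := h
  · exact h.not_hasShortZeroSum hexp hB
  · exact h.not_hasShortZeroSum hexp hB
  · exact h.not_hasShortZeroSum hexp hB

end Converse

section Eta

variable {G : Type*} [AddCommGroup G] {n : ℕ}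

theorem eta_eq_add_one {m : ℕ} (hle : ∀ S : Multiset G, ¬HasShortZeroSum S → S.card ≤ m)
    (hmax : ∃ S : Multiset G, S.card = m ∧ ¬HasShortZeroSum S) : eta G = m + 1 := by
  obtain ⟨S, hcard, hS⟩ := hmax
  have hmem : m + 1 ∈ {l : ℕ | ∀ S : Multiset G, l ≤ S.card → HasShortZeroSum S} :=
    fun T hT => by_contra fun h => (hle T h).not_gt hT
  refine le_antisymm (Nat.sInf_le hmem) (le_csInf ⟨_, hmem⟩ fun l hl => ?_)
  by_contra! hlt
  exact hS (hl S (by lia))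

theorem IsStandardBasis.exists_hasExtremalForm {f₁ f₂ f₃ : G} (hn : 0 < n)
    (hB : IsStandardBasis n f₁ f₂ f₃) :
    ∃ S : Multiset G, S.card = 2 * n + 3 ∧ HasExtremalForm n S := by
  have hcard : (Multiset.replicate (2 * n - 1) 0 + {f₁, f₂}).card = 2 * n + 1 := by
    simp only [Multiset.insert_eq_cons, Multiset.card_add, Multiset.card_replicate,
      Multiset.card_cons, Multiset.card_singleton]
    lia
  refine ⟨_, ?_, f₁, f₂, f₃, hB, .inr (.inr (hB.formEta3 hcard ?_ ?_))⟩
  · rw [Multiset.card_add, Multiset.card_map, hcard, Multiset.card_pair]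
  · simp +contextual [Multiset.mem_replicate, or_imp]
  · simp

theorem card_of_equiv (e : G ≃+ ZMod 2 × ZMod 2 × ZMod (2 * n)) : Nat.card G = 8 * n := by
  simp only [Nat.card_congr e.toEquiv, Nat.card_prod, Nat.card_zmod]
  lia

theorem exists_isStandardBasis (hn : 0 < n) (e : G ≃+ ZMod 2 × ZMod 2 × ZMod (2 * n)) :
    ∃ f₁ f₂ f₃ : G, IsStandardBasis n f₁ f₂ f₃ := by
  refine ⟨e.symm (1, 0, 0), e.symm (0, 1, 0), e.symm (0, 0, 1),
    isStandardBasis_of_card hn (card_of_equiv e) ?_ ?_ ?_ ?_⟩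
  · rw [← map_add]
    simp [CharTwo.add_self_eq_zero]
  · rw [← map_add]
    simp [CharTwo.add_self_eq_zero]
  · have hzero : n • (1 + 1 : ZMod (2 * n)) = 0 := by
      rw [nsmul_eq_mul, one_add_one_eq_two]
      exact (mul_comm _ _).trans (mod_cast ZMod.natCast_self (2 * n))
    rw [← map_add, ← map_nsmul]
    simp [hzero]
  · refine (AddSubgroup.eq_top_iff' _).2 fun g => ?_
    obtain ⟨⟨p, q, r⟩, rfl⟩ := e.symm.surjective g
    obtain ⟨p, rfl⟩ := ZMod.intCast_surjective p
    obtain ⟨q, rfl⟩ := ZMod.intCast_surjective q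
    obtain ⟨r, rfl⟩ := ZMod.intCast_surjective r
    have hg : e.symm (p, q, r) =
        p • e.symm (1, 0, 0) + q • e.symm (0, 1, 0) + r • e.symm (0, 0, 1) := by
      simp [← map_zsmul, ← map_add]
    rw [hg]
    exact add_mem (add_mem (zsmul_mem (AddSubgroup.subset_closure (by simp)) p)
      (zsmul_mem (AddSubgroup.subset_closure (by simp)) q))
      (zsmul_mem (AddSubgroup.subset_closure (by simp)) r)

/-- Reduction modulo `2` on `C₂ ⊕ C₂ ⊕ C₂ₙ`. -/
def reduceModTwo (n : ℕ) : ZMod 2 × ZMod 2 × ZMod (2 * n) →+ ZMod 2 × ZMod 2 × ZMod 2 :=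
  (AddMonoidHom.id _).prodMap ((AddMonoidHom.id _).prodMap
    (ZMod.castHom (dvd_mul_right 2 n) (ZMod 2)).toAddMonoidHom)

theorem reduceModTwo_surjective : Function.Surjective (reduceModTwo n) :=
  Function.surjective_id.prodMap
    (Function.surjective_id.prodMap (ZMod.castHom_surjective (dvd_mul_right 2 n)))

theorem reduction_of_equiv (hn : 2 ≤ n) (e : G ≃+ ZMod 2 × ZMod 2 × ZMod (2 * n)) :
    Reduction ((reduceModTwo n).comp e.toAddMonoidHom) n := by
  have hsurj : Function.Surjective ((reduceModTwo n).comp e.toAddMonoidHom) :=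
    reduceModTwo_surjective.comp e.surjective
  have hV : Nat.card (ZMod 2 × ZMod 2 × ZMod 2) = 8 := by simp
  have hcard := card_of_equiv e
  refine ⟨hn, ?_, hsurj, ?_, hV⟩
  · have (m : ℕ) : lcm 2 (2 * m) = 2 * m := Nat.lcm_eq_right (dvd_mul_right 2 m)
    rw [AddMonoid.exponent_eq_of_addEquiv e, AddMonoid.exponent_prod, AddMonoid.exponent_prod,
      ZMod.exponent, ZMod.exponent, this, this]
  · have hmul := ((reduceModTwo n).comp e.toAddMonoidHom).ker.card_mul_index
    rw [AddSubgroup.index_ker, AddMonoidHom.range_eq_top.2 hsurj, AddSubgroup.card_top, hV,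
      hcard] at hmul
    lia

end Eta

end ZeroSum

theorem theorem4p1 {G : Type*} [AddCommGroup G] (n : ℕ) (hn : 2 ≤ n)
    (hG : Nonempty (G ≃+ ZMod 2 × ZMod 2 × ZMod (2 * n))) :
    ZeroSum.eta G = 2 * n + 4 ∧
    ∀ S : Multiset G, S.card = 2 * n + 3 →
      (¬ ZeroSum.HasShortZeroSum S ↔
        ∃ f₁ f₂ f₃ : G, ZeroSum.IsBasis ![f₁, f₂, f₃] ∧
          addOrderOf f₁ = 2 ∧ addOrderOf f₂ = 2 ∧ addOrderOf f₃ = 2 * n ∧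
          (ZeroSum.FormEta1 n f₁ f₂ f₃ S ∨ ZeroSum.FormEta2 n f₁ f₂ f₃ S ∨
            ZeroSum.FormEta3 n f₁ f₂ f₃ S)) := by
  obtain ⟨e⟩ := hG
  have hR := ZeroSum.reduction_of_equiv hn e
  refine ⟨ZeroSum.eta_eq_add_one (fun S hS => Nat.le_of_lt_succ (hR.card_lt hS)) ?_,
    fun S hcard => ⟨fun hS => ?_, ?_⟩⟩
  · obtain ⟨f₁, f₂, f₃, hB⟩ := ZeroSum.exists_isStandardBasis (by lia) e
    obtain ⟨S, hcard, hS⟩ := hB.exists_hasExtremalForm (by lia)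
    exact ⟨S, hcard, hS.not_hasShortZeroSum hR.exponent⟩
  · obtain ⟨x, a, b, c, d, U, hU⟩ := hR.exists_shape hS hcard
    obtain ⟨f₁, f₂, f₃, hB, hform⟩ := hU.hasExtremalForm hn hR.card_domain
    exact ⟨f₁, f₂, f₃, hB.isBasis, hB.addOrderOf_fst, hB.addOrderOf_snd, hB.addOrderOf_trd, hform⟩
  · rintro ⟨f₁, f₂, f₃, hB, h₁, h₂, h₃, hform⟩
    exact ZeroSum.HasExtremalForm.not_hasShortZeroSum hR.exponent
      ⟨f₁, f₂, f₃, ⟨hB, h₁, h₂, h₃⟩, hform⟩
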